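/- Let $q$ be a prime power, let $\mathbb{F}_q$ be the finite field with $q$ elements, and let $m_1,n_1,m_2,n_2$ be integers in $\{1,\dots,q-1\}$. For integers $1\le m,n\le q-1$, let $D(q;m,n)$ denote the digraph (loops allowed) with vertex set $\mathbb{F}_q^2$ in which there is an arc from $(x_1,x_2)$ to $(y_1,y_2)$ if and only if $x_2+y_2=x_1^m y_1^n$. Let $G(q;m,n)$ denote its bipartite cover: the bipartite graph whose two parts $X$ and $Y$ are disjoint copies of $\mathbb{F}_q^2$, a vertex $(x_1,x_2)\in X$ being adjacent to a vertex $(y_1,y_2)\in Y$ if and only if $x_2+y_2=x_1^m y_1^n$. If the digraphs $D(q;m_1,n_1)$ and $D(q;m_2,n_2)$ are isomorphic, then the graphs $G(q;m_1,n_1)$ and $G(q;m_2,n_2)$ are isomorphic, and $$\{\gcd(m_1,q-1),\gcd(n_1,q-1)\}=\{\gcd(m_2,q-1),\gcd(n_2,q-1)\}$$ as multisets. -/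

import Mathlib

/-- An isomorphism of digraphs: a bijection of the vertices such that `φ x → φ y` is an arc of `E`
if and only if `x → y` is an arc of `D` (loops included). -/
abbrev DigraphIso {V W : Type*} (D : Digraph V) (E : Digraph W) : Type _ :=
  D.Adj ≃r E.Adj

/-- The digraph `D(q; f)` on `F × F`: there is an arc from `(x₁, x₂)` to `(y₁, y₂)` if and only if
`x₂ + y₂ = f x₁ y₁`. -/
def algDigraph {F : Type*} [Field F] (f : F → F → F) : Digraph (F × F) where
  Adj x y := x.2 + y.2 = f x.1 y.1

/-- The monomial digraph `D(q; m, n)` over the field `F`, with `f(x, y) = x ^ m * y ^ n`. -/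
def monomialDigraph (F : Type*) [Field F] (m n : ℕ) : Digraph (F × F) :=
  algDigraph fun x y => x ^ m * y ^ n

/-- The bipartite cover of a digraph `D`: the vertex set consists of two disjoint copies
of the vertex set of `D`, and `x` in the first copy is joined to `y` in the second copy
if and only if `x → y` is an arc of `D`. -/
def Digraph.bipartiteCover {V : Type*} (D : Digraph V) : SimpleGraph (V ⊕ V) where
  Adj
    | Sum.inl x, Sum.inr y => D.Adj x y
    | Sum.inr y, Sum.inl x => D.Adj x y
    | _, _ => False
  symm := ⟨by rintro (x | x) (y | y) h <;> exact h⟩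
  loopless := ⟨by rintro (x | x) h <;> exact h⟩

/-- The monomial bipartite graph `G(q; m, n)` over the field `F`. -/
def monomialGraph (F : Type*) [Field F] (m n : ℕ) : SimpleGraph ((F × F) ⊕ (F × F)) :=
  (monomialDigraph F m n).bipartiteCover

theorem monomialGraph_adj_inl_inr {F : Type*} [Field F] (m n : ℕ) (p l : F × F) :
    (monomialGraph F m n).Adj (Sum.inl p) (Sum.inr l) ↔ p.2 + l.2 = p.1 ^ m * l.1 ^ n :=
  Iff.rfl

/-! An isomorphism preserves the sizes of classes of vertices with equal out-neighbourhoods. In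
`D(q; m, n)` such a class is a fibre of `t ↦ t ^ m` with the second coordinate fixed, so the largest
class size is `gcd(m, q - 1)`. Reversing arcs gives the same for `n`. Hence the gcds agree even as
ordered pairs. -/

/-- The vertices with the same set of out-neighbours as `x`. -/
def outTwins {V : Type*} (r : V → V → Prop) (x : V) : Set V :=
  {x' | ∀ y, r x' y ↔ r x y}

/-- An isomorphism of relations maps twin classes to twin classes. -/
theorem ncard_outTwins_relIso {V W : Type*} {r : V → V → Prop} {s : W → W → Prop}
    (e : r ≃r s) (x : V) : (outTwins s (e x)).ncard = (outTwins r x).ncard := by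
  have h : outTwins s (e x) = e '' outTwins r x := by
    ext w
    obtain ⟨w, rfl⟩ := e.surjective w
    simp only [outTwins, Set.mem_ofPred_eq, Set.mem_image, e.injective.eq_iff, exists_eq_right,
      e.surjective.forall, e.map_rel_iff]
  rw [h, Set.ncard_image_of_injective _ e.injective]

section Monomial

variable {F : Type*} [Field F]

/-- Two vertices of a monomial digraph have the same out-neighbours if and only if their second
coordinates and the `m`-th powers of their first coordinates agree. -/
theorem outTwins_monomialDigraph (m : ℕ) {n : ℕ} (hn : n ≠ 0) (x : F × F) :
    outTwins (monomialDigraph F m n).Adj x = {t | t ^ m = x.1 ^ m} ×ˢ {x.2} := by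
  ext ⟨u, v⟩
  change (∀ y : F × F, v + y.2 = u ^ m * y.1 ^ n ↔ x.2 + y.2 = x.1 ^ m * y.1 ^ n) ↔
    u ^ m = x.1 ^ m ∧ v = x.2
  refine ⟨fun h => ?_, ?_⟩
  · have hv : v = x.2 := by
      -- Since `n ≠ 0`, the monomial vanishes at `y₁ = 0`, so such neighbours detect only the second
      -- coordinate; `y₁ = 1` then isolates `u ^ m`.
      have := (h (0, -v)).1 (by simp [hn])
      simp only [ne_eq, hn, not_false_eq_true, zero_pow, mul_zero] at this
      linear_combination -this
    have := (h (1, u ^ m - v)).1 (by simp)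
    simp only [one_pow, mul_one] at this
    exact ⟨by linear_combination this + hv, hv⟩
  · rintro ⟨hu, rfl⟩ y
    rw [hu]

theorem ncard_outTwins_monomialDigraph (m : ℕ) {n : ℕ} (hn : n ≠ 0) (x : F × F) :
    (outTwins (monomialDigraph F m n).Adj x).ncard = {t : F | t ^ m = x.1 ^ m}.ncard := by
  rw [outTwins_monomialDigraph m hn, Set.ncard_prod, Set.ncard_singleton, mul_one]

variable [Finite F]

/-- The number of solutions of `t ^ m = 1` in a finite field. -/
theorem ncard_pow_eq_one {m : ℕ} (hm : m ≠ 0) :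
    {t : F | t ^ m = 1}.ncard = Nat.gcd m (Nat.card F - 1) := by
  have h : {t : F | t ^ m = 1} = Units.val '' {t : Fˣ | t ^ m = 1} := by
    ext t
    simp only [Set.mem_ofPred_eq, Set.mem_image]
    constructor
    · intro ht
      exact ⟨Units.ofPowEqOne t m ht hm, by ext; simp, rfl⟩
    · rintro ⟨t, ht, rfl⟩
      simpa using congrArg Units.val ht
  have hk : {t : Fˣ | t ^ m = 1} = ((powMonoidHom m : Fˣ →* Fˣ).ker : Set Fˣ) := by
    ext t
    simp [MonoidHom.mem_ker]
  rw [h, Set.ncard_image_of_injective _ Units.val_injective, hk, ← Nat.card_coe_set_eq,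
    ← Nat.card_units, Nat.gcd_comm]
  exact IsCyclic.card_powMonoidHom_ker Fˣ m

/-- A power map on a finite field has fibres of size at most that of the fibre of `1`. -/
theorem ncard_pow_eq_pow_le {m : ℕ} (hm : m ≠ 0) (u : F) :
    {t : F | t ^ m = u ^ m}.ncard ≤ {t : F | t ^ m = 1}.ncard := by
  obtain rfl | hu := eq_or_ne u 0
  · have h : {t : F | t ^ m = 0 ^ m} = {0} := by
      ext t
      simp [hm]
    rw [h, Set.ncard_singleton, Nat.one_le_iff_ne_zero]
    exact Set.ncard_ne_zero_of_mem (a := 1) (one_pow m)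
  · refine Set.ncard_le_ncard_of_injOn (· / u) (fun t ht => ?_)
      (fun a _ b _ h => (div_left_inj' hu).1 h)
    change (t / u) ^ m = 1
    rw [div_pow, show t ^ m = u ^ m from ht, div_self (pow_ne_zero m hu)]

/-- The class of `(1, 0)` attains the maximal size. Its image may have first coordinate `0`, where
the fibre is a singleton, so one isomorphism is used only for an inequality; its inverse gives the
other. -/
theorem gcd_le_of_monomialDigraph_iso {m₁ n₁ m₂ n₂ : ℕ}
    (hm₁ : m₁ ≠ 0) (hn₁ : n₁ ≠ 0) (hm₂ : m₂ ≠ 0) (hn₂ : n₂ ≠ 0)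
    (e : (monomialDigraph F m₁ n₁).Adj ≃r (monomialDigraph F m₂ n₂).Adj) :
    Nat.gcd m₁ (Nat.card F - 1) ≤ Nat.gcd m₂ (Nat.card F - 1) := by
  have h := ncard_outTwins_relIso e (1, 0)
  rw [ncard_outTwins_monomialDigraph m₁ hn₁, ncard_outTwins_monomialDigraph m₂ hn₂, one_pow,
    ncard_pow_eq_one hm₁] at h
  rw [← h, ← ncard_pow_eq_one hm₂]
  exact ncard_pow_eq_pow_le hm₂ _

theorem gcd_eq_of_monomialDigraph_iso {m₁ n₁ m₂ n₂ : ℕ}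
    (hm₁ : m₁ ≠ 0) (hn₁ : n₁ ≠ 0) (hm₂ : m₂ ≠ 0) (hn₂ : n₂ ≠ 0)
    (e : (monomialDigraph F m₁ n₁).Adj ≃r (monomialDigraph F m₂ n₂).Adj) :
    Nat.gcd m₁ (Nat.card F - 1) = Nat.gcd m₂ (Nat.card F - 1) :=
  le_antisymm (gcd_le_of_monomialDigraph_iso hm₁ hn₁ hm₂ hn₂ e)
    (gcd_le_of_monomialDigraph_iso hm₂ hn₂ hm₁ hn₁ e.symm)

end Monomial

/-- Reversing all arcs of a monomial digraph interchanges the two exponents. -/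
theorem monomialDigraph_adj_comm {F : Type*} [Field F] (m n : ℕ) (x y : F × F) :
    (monomialDigraph F m n).Adj x y ↔ (monomialDigraph F n m).Adj y x := by
  change x.2 + y.2 = x.1 ^ m * y.1 ^ n ↔ y.2 + x.2 = y.1 ^ n * x.1 ^ m
  rw [add_comm, mul_comm]

/-- An isomorphism of digraphs, reversed: the exponents are interchanged on both sides. -/
def monomialDigraphIsoSwap {F : Type*} [Field F] {m₁ n₁ m₂ n₂ : ℕ}
    (e : (monomialDigraph F m₁ n₁).Adj ≃r (monomialDigraph F m₂ n₂).Adj) :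
    (monomialDigraph F n₁ m₁).Adj ≃r (monomialDigraph F n₂ m₂).Adj where
  toEquiv := e.toEquiv
  map_rel_iff' {x y} := by
    rw [monomialDigraph_adj_comm n₂ m₂, monomialDigraph_adj_comm n₁ m₁]
    exact e.map_rel_iff

/-- Isomorphic digraphs have isomorphic bipartite covers. -/
def bipartiteCoverIso {V W : Type*} {D : Digraph V} {E : Digraph W} (e : D.Adj ≃r E.Adj) :
    D.bipartiteCover ≃g E.bipartiteCover where
  toEquiv := Equiv.sumCongr e.toEquiv e.toEquiv
  map_rel_iff' {x y} := by
    rcases x with x | x <;> rcases y with y | y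
    · exact Iff.rfl
    · exact e.map_rel_iff
    · exact e.map_rel_iff
    · exact Iff.rfl

theorem mainTheorem5 (F : Type*) [Field F] [Finite F] (q : ℕ) (hq : Nat.card F = q)
    (m₁ n₁ m₂ n₂ : ℕ)
    (hm₁ : 1 ≤ m₁ ∧ m₁ ≤ q - 1) (hn₁ : 1 ≤ n₁ ∧ n₁ ≤ q - 1)
    (hm₂ : 1 ≤ m₂ ∧ m₂ ≤ q - 1) (hn₂ : 1 ≤ n₂ ∧ n₂ ≤ q - 1)
    (hD : Nonempty (DigraphIso (monomialDigraph F m₁ n₁) (monomialDigraph F m₂ n₂))) :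
    Nonempty (monomialGraph F m₁ n₁ ≃g monomialGraph F m₂ n₂) ∧
      ({Nat.gcd m₁ (q - 1), Nat.gcd n₁ (q - 1)} : Multiset ℕ) =
        {Nat.gcd m₂ (q - 1), Nat.gcd n₂ (q - 1)} := by
  obtain ⟨e⟩ := hD
  subst hq
  have hm₁ := Nat.one_le_iff_ne_zero.1 hm₁.1
  have hn₁ := Nat.one_le_iff_ne_zero.1 hn₁.1
  have hm₂ := Nat.one_le_iff_ne_zero.1 hm₂.1
  have hn₂ := Nat.one_le_iff_ne_zero.1 hn₂.1
  refine ⟨⟨bipartiteCoverIso e⟩, ?_⟩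
  rw [gcd_eq_of_monomialDigraph_iso hm₁ hn₁ hm₂ hn₂ e,
    gcd_eq_of_monomialDigraph_iso hn₁ hm₁ hn₂ hm₂ (monomialDigraphIsoSwap e)]
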